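/- Let $D$ be an integral domain with quotient field $K$. An overring of $D$ is a subring of $K$ containing $D$. An ideal of $D$ is an MNI ideal if it is maximal among the non-invertible ideals of $D$. $D$ is an MPD domain if it has a unique MNI ideal $Q$ and every nonzero non-invertible ideal of $D$ has the form $JQ$ for some invertible ideal $J$ of $D$. $D$ is h-local if every nonzero ideal of $D$ is contained in only finitely many maximal ideals and every nonzero prime ideal is contained in a unique maximal ideal. $D$ is a GMPD (globalized multiplicatively pinched-Dedekind) domain if it is h-local and the localization $D_M$ is an MPD domain for every maximal ideal $M$ of $D$. Proposition. For a GMPD domain $D$, the following assertions are equivalent: (a) the set of all overrings of $D$ is finite; (b) each chain of overrings of $D$ (with respect to inclusion) is finite; (c) $\mathrm{Spec}(D)$ is finite; (d) $\mathrm{Max}(D)$ is finite. -/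

import Mathlib

/-- An ideal `I` of `D` is invertible if it is a unit in the monoid of fractional ideals of `D`
(inside the quotient field): `I * I' = D` for some fractional ideal `I'`.
In particular the zero ideal of a domain is not invertible. -/
def IsInvertibleIdeal {D : Type*} [CommRing D] (I : Ideal D) : Prop :=
  IsUnit (I : FractionalIdeal (nonZeroDivisors D) (FractionRing D))

/-- An MNI ideal: an ideal that is maximal (for inclusion) among the non-invertible ideals. -/
def IsMNIIdeal {D : Type*} [CommRing D] (Q : Ideal D) : Prop :=
  Maximal (fun I : Ideal D => ¬ IsInvertibleIdeal I) Q

/-- A domain `D` is a multiplicatively pinched-Dedekind (MPD) domain if it has a unique MNI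
ideal `Q`, and every nonzero non-invertible ideal of `D` is of the form `J * Q` with `J` an
invertible ideal of `D`. (For a Dedekind domain, `Q = 0` and the second condition is void.) -/
def IsMPD (D : Type*) [CommRing D] : Prop :=
  ∃ Q : Ideal D, IsMNIIdeal Q ∧ (∀ Q' : Ideal D, IsMNIIdeal Q' → Q' = Q) ∧
    ∀ I : Ideal D, I ≠ ⊥ → ¬ IsInvertibleIdeal I →
      ∃ J : Ideal D, IsInvertibleIdeal J ∧ I = J * Q

/-- A domain is h-local if each nonzero ideal is contained in only finitely many maximal ideals
and each nonzero prime ideal is contained in a unique maximal ideal. -/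
structure IsHLocal (D : Type*) [CommRing D] : Prop where
  finite_maximal : ∀ I : Ideal D, I ≠ ⊥ → {M : Ideal D | M.IsMaximal ∧ I ≤ M}.Finite
  unique_maximal : ∀ P : Ideal D, P.IsPrime → P ≠ ⊥ → ∃! M : Ideal D, M.IsMaximal ∧ P ≤ M

/-- A domain is a globalized multiplicatively pinched-Dedekind (GMPD) domain if it is h-local and
all its localizations at maximal ideals are MPD domains. -/
structure IsGMPD (D : Type*) [CommRing D] : Prop where
  hLocal : IsHLocal D
  isMPD_localization : ∀ (M : Ideal D) [M.IsMaximal], IsMPD (Localization.AtPrime M)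

/-- The overrings of a domain `D` with quotient field `K`: the subrings of `K` containing `D`. -/
abbrev Overring (D K : Type*) [CommRing D] [Field K] [Algebra D K] : Type _ :=
  Subalgebra D K

/-! The core is local: an MPD local domain `A` has at most three overrings. Invertible ideals of `A`
are principal, so if `Q = 0` every ideal is principal and only `A` and `K` occur. Otherwise `Q` is
not principal and `IsPinchedBy Q` holds; the overrings are then `A`, `(Q : Q)` and `K`
(`IsPinchedBy.subalgebra_eq`). Two facts carry this: `Q` lies in every nonzero prime, and any
nonzero `a`, `b` satisfy `a / b ∈ (Q : Q)` or `b / a ∈ Q`.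

Globally, an overring of `D` is determined by its localizations at the maximal ideals, so finitely
many maximal ideals allow finitely many overrings. Conversely, infinitely many maximal ideals yield
an infinite descending chain of intersections of the `D_M`, and distinct primes have distinct
localizations. -/

/-- Every nonzero ideal is principal or a nonzero principal multiple of `Q`. -/
def IsPinchedBy {A : Type*} [CommRing A] (Q : Ideal A) : Prop :=
  ∀ I : Ideal A, I ≠ ⊥ → I.IsPrincipal ∨ ∃ x : A, x ≠ 0 ∧ I = Ideal.span {x} * Q

/-! ### Principal multiples of ideals -/

theorem Ideal.exists_span_singleton_mul_eq {A : Type*} [CommRing A] {I : Ideal A} {x : A}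
    (h : I ≤ Ideal.span {x}) : ∃ J : Ideal A, I = Ideal.span {x} * J := by
  refine ⟨Submodule.comap (LinearMap.mulLeft A x) I, ?_⟩
  ext y
  rw [Ideal.mem_span_singleton_mul]
  constructor
  · intro hy
    obtain ⟨z, rfl⟩ := Ideal.mem_span_singleton.1 (h hy)
    exact ⟨z, hy, rfl⟩
  · rintro ⟨z, hz, rfl⟩
    exact hz

theorem Ideal.isPrincipal_of_span_singleton_mul {A : Type*} [CommRing A] [IsDomain A]
    {I : Ideal A} {c : A} (hc : c ≠ 0) (h : (Ideal.span {c} * I).IsPrincipal) :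
    I.IsPrincipal := by
  obtain ⟨g, hg⟩ := h
  rw [Ideal.submodule_span_eq] at hg
  have hgm : g ∈ Ideal.span {c} * I := hg ▸ Ideal.mem_span_singleton_self g
  obtain ⟨m, hm, rfl⟩ := Ideal.mem_span_singleton_mul.1 hgm
  refine ⟨m, ?_⟩
  rw [← Ideal.span_singleton_mul_span_singleton] at hg
  exact (Ideal.span_singleton_mul_right_inj hc).1 hg

theorem Ideal.eq_bot_of_fg_of_le_span_singleton_mul {A : Type*} [CommRing A] [IsLocalRing A]
    {I : Ideal A} (hI : I.FG) {x : A} (hx : ¬ IsUnit x) (h : I ≤ Ideal.span {x} * I) : I = ⊥ := by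
  refine Submodule.eq_bot_of_le_smul_of_le_jacobson_bot (Ideal.span {x}) I hI h ?_
  rw [IsLocalRing.jacobson_eq_maximalIdeal ⊥ bot_ne_top, Ideal.span_singleton_le_iff_mem]
  exact hx

/-! ### Ideal theory of a domain pinched by a non-principal `Q` -/

namespace IsPinchedBy

variable {A : Type*} [CommRing A] {Q : Ideal A}

theorem ne_bot_of_not_isPrincipal (hn : ¬ Q.IsPrincipal) : Q ≠ ⊥ := by
  rintro rfl
  exact hn inferInstance

theorem ne_top_of_not_isPrincipal (hn : ¬ Q.IsPrincipal) : Q ≠ ⊤ := by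
  rintro rfl
  exact hn inferInstance

variable [IsDomain A]

/-- Write `cQ = xJ`. A principal `J` would make `Q` principal, so pinching turns `J` into a multiple
of `Q`. -/
theorem exists_span_singleton_mul_eq (hQ : IsPinchedBy Q) (hn : ¬ Q.IsPrincipal) {c x : A}
    (hc : c ≠ 0) (h : Ideal.span {c} * Q ≤ Ideal.span {x}) :
    ∃ z : A, z ≠ 0 ∧ Ideal.span {c} * Q = Ideal.span {x} * (Ideal.span {z} * Q) := by
  obtain ⟨J, hJ⟩ := Ideal.exists_span_singleton_mul_eq h
  have hJp : ¬ J.IsPrincipal := by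
    rintro ⟨g, rfl⟩
    refine hn (Ideal.isPrincipal_of_span_singleton_mul hc ?_)
    rw [hJ, Ideal.submodule_span_eq, Ideal.span_singleton_mul_span_singleton]
    exact ⟨_, rfl⟩
  obtain h | ⟨z, hz, rfl⟩ := hQ J (ne_bot_of_not_isPrincipal hJp)
  · exact absurd h hJp
  · exact ⟨z, hz, hJ⟩

variable [IsLocalRing A]

theorem le_of_isPrime (hQ : IsPinchedBy Q) (hn : ¬ Q.IsPrincipal) {P : Ideal A} (hP : P.IsPrime)
    (hP0 : P ≠ ⊥) : Q ≤ P := by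
  have hQM : Q ≤ IsLocalRing.maximalIdeal A :=
    IsLocalRing.le_maximalIdeal (ne_top_of_not_isPrincipal hn)
  obtain ⟨p, rfl⟩ | ⟨x, hx, rfl⟩ := hQ P hP0
  · rw [Ideal.submodule_span_eq] at *
    have hp0 : p ≠ 0 := by simpa using hP0
    have hp : Prime p := (Ideal.span_singleton_prime hp0).1 hP
    intro q hq
    rw [Ideal.mem_span_singleton]
    -- Pinching is applied to `(p) + qM`, with `M` the maximal ideal; each of its two forms forces
    -- `p ∣ q`.
    have hJ0 : Ideal.span {p} ⊔ Ideal.span {q} * IsLocalRing.maximalIdeal A ≠ ⊥ := fun h =>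
      hP0 (le_bot_iff.1 (h ▸ le_sup_left))
    have hpJ : p ∈ Ideal.span {p} ⊔ Ideal.span {q} * IsLocalRing.maximalIdeal A :=
      le_sup_left (a := Ideal.span {p}) (Ideal.mem_span_singleton_self p)
    obtain ⟨g, hg⟩ | ⟨x, hx, hJ⟩ := hQ _ hJ0
    · rw [Ideal.submodule_span_eq] at hg
      rw [hg, Ideal.mem_span_singleton] at hpJ
      have hqg : ∀ m ∈ IsLocalRing.maximalIdeal A, g ∣ q * m := fun m hm => by
        rw [← Ideal.mem_span_singleton, ← hg]
        exact le_sup_right (a := Ideal.span {p})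
          (Ideal.mul_mem_mul (Ideal.mem_span_singleton_self q) hm)
      obtain ⟨u, hu⟩ := hpJ
      obtain hgu | hgu := hp.irreducible.isUnit_or_isUnit hu
      · have htop : Ideal.span {p} ⊔ Ideal.span {q} * IsLocalRing.maximalIdeal A = ⊤ := by
          rw [hg, Ideal.span_singleton_eq_top]
          exact hgu
        exfalso
        refine (IsLocalRing.maximalIdeal.isMaximal A).ne_top (top_le_iff.1 (htop ▸ sup_le ?_ ?_))
        · rw [Ideal.span_singleton_le_iff_mem]
          exact hp.not_isUnit
        · exact Ideal.mul_le_right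
      · have hgp : p ∣ g := by
          rw [hu]
          exact (hgu.mul_right_dvd).2 dvd_rfl
        have := hgp.trans (hqg q (hQM hq))
        exact (hp.dvd_or_dvd this).elim id id
    · rw [hJ] at hpJ
      obtain ⟨m, hm, hxm⟩ := Ideal.mem_span_singleton_mul.1 hpJ
      obtain hxu | hmu := hp.irreducible.isUnit_or_isUnit hxm.symm
      · rw [Ideal.span_singleton_eq_top.2 hxu, Ideal.top_mul] at hJ
        have hqJ := hq
        rw [← hJ] at hqJ
        obtain ⟨a, ha, b, hb, hab⟩ := Submodule.mem_sup.1 hqJ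
        obtain ⟨n, hn', rfl⟩ := Ideal.mem_span_singleton_mul.1 hb
        have h1 : p ∣ q * (1 - n) := by
          rw [← Ideal.mem_span_singleton]
          convert ha using 1
          linear_combination -hab
        have h2 : IsUnit (1 - n) := IsLocalRing.isUnit_one_sub_self_of_mem_nonunits n hn'
        exact (h2.dvd_mul_right).1 h1
      · exact absurd hmu (hQM hm)
  · obtain h | h := hP.mul_le.1 le_rfl
    -- `x ∈ xQ` would give `1 ∈ Q`.
    · exfalso
      have hxP := h (Ideal.mem_span_singleton_self x)
      obtain ⟨q, hq, hxq⟩ := Ideal.mem_span_singleton_mul.1 hxP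
      have : q = 1 := mul_left_cancel₀ hx (by simpa using hxq)
      exact ne_top_of_not_isPrincipal hn ((Ideal.eq_top_iff_one Q).2 (this ▸ hq))
    · exact h

/-- Pinching `(s) + Q` gives `Q ≤ (s)`; then `Q = s(zQ)` for some `z`, which lies in `sQ`. -/
theorem span_singleton_mul_eq (hQ : IsPinchedBy Q) (hn : ¬ Q.IsPrincipal) {s : A} (hs : s ∉ Q) :
    Ideal.span {s} * Q = Q := by
  have hQs : Q ≤ Ideal.span {s} := by
    have h0 : Ideal.span {s} ⊔ Q ≠ ⊥ := fun h =>
      ne_bot_of_not_isPrincipal hn (le_bot_iff.1 (h ▸ le_sup_right))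
    have hsJ : s ∈ Ideal.span {s} ⊔ Q :=
      le_sup_left (b := Q) (Ideal.mem_span_singleton_self s)
    obtain ⟨g, hg⟩ | ⟨x, hx, hJ⟩ := hQ _ h0
    · rw [Ideal.submodule_span_eq] at hg
      have hgJ : g ∈ Ideal.span {s} ⊔ Q := hg ▸ Ideal.mem_span_singleton_self g
      obtain ⟨b, hb⟩ := Ideal.mem_span_singleton.1 (hg ▸ hsJ)
      obtain ⟨a, ha, q, hq, haq⟩ := Submodule.mem_sup.1 hgJ
      obtain ⟨a, rfl⟩ := Ideal.mem_span_singleton.1 ha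
      by_cases hbu : IsUnit b
      · refine le_sup_right.trans (hg.le.trans (Ideal.span_singleton_le_span_singleton.2 ?_))
        rw [hb]
        exact (hbu.mul_right_dvd).2 dvd_rfl
      · exfalso
        have h1 : IsUnit (1 - b * a) := IsLocalRing.isUnit_one_sub_self_of_mem_nonunits _
          (Ideal.mul_mem_right a (IsLocalRing.maximalIdeal A) hbu)
        have h2 : g * (1 - b * a) ∈ Q := by
          convert hq using 1
          rw [hb] at haq
          linear_combination -haq
        have h3 : g ∈ Q := (Ideal.mul_unit_mem_iff_mem Q h1).1 h2
        exact hs (hb ▸ Q.mul_mem_right b h3)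
    · rw [hJ] at hsJ
      exact absurd (Ideal.mul_le_right hsJ) hs
  obtain ⟨z, hz, h⟩ := hQ.exists_span_singleton_mul_eq hn (c := 1) (x := s) one_ne_zero
    (by simpa using hQs)
  rw [Ideal.span_singleton_one, Ideal.top_mul] at h
  refine le_antisymm Ideal.mul_le_right ?_
  conv_lhs => rw [h]
  exact Ideal.mul_mono_right Ideal.mul_le_right

theorem isUnit_of_notMem (hQ : IsPinchedBy Q) (hn : ¬ Q.IsPrincipal) (hfg : Q.FG) {s : A}
    (hs : s ∉ Q) : IsUnit s := by
  by_contra hu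
  exact ne_bot_of_not_isPrincipal hn (Ideal.eq_bot_of_fg_of_le_span_singleton_mul hfg hu
    (hQ.span_singleton_mul_eq hn hs).ge)

/-- If `Q` is generated by two elements, it is stable: its square is a multiple of `Q` by an
element of `Q`. -/
theorem exists_mul_self_eq (hQ : IsPinchedBy Q) (hn : ¬ Q.IsPrincipal) {c d : A}
    (hQcd : Q = Ideal.span {c, d}) (hc0 : c ≠ 0) (hd0 : d ≠ 0) :
    ∃ y, y ≠ 0 ∧ y ∈ Q ∧ Q * Q = Ideal.span {y} * Q := by
  have hQ0 := ne_bot_of_not_isPrincipal hn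
  have hfg : Q.FG := hQcd ▸ (Submodule.fg_span (by simp))
  have hc : c ∈ Q := hQcd ▸ Ideal.subset_span (by simp)
  have hd : d ∈ Q := hQcd ▸ Ideal.subset_span (by simp)
  have hnu : ∀ s ∈ Q, ¬ IsUnit s := fun s hs hu =>
    ne_top_of_not_isPrincipal hn (Ideal.eq_top_of_isUnit_mem Q hs hu)
  have hQQ0 : Q * Q ≠ ⊥ := mul_ne_zero hQ0 hQ0
  obtain ⟨g, hg⟩ | ⟨y, hy, hJ⟩ := hQ _ hQQ0
  -- If `Q² = (g)`, then `cQ` and `dQ` are multiples of `gQ`, so `g ∈ gQ` and `1 ∈ Q`.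
  · exfalso
    rw [Ideal.submodule_span_eq] at hg
    have hg0 : g ≠ 0 := by rintro rfl; simp [hQ0] at hg
    have hle : ∀ w ∈ Q, Ideal.span {w} * Q ≤ Ideal.span {g} := fun w hw =>
      hg ▸ Ideal.mul_mono_left ((Ideal.span_singleton_le_iff_mem Q).2 hw)
    obtain ⟨z, hz, h1⟩ := hQ.exists_span_singleton_mul_eq hn hc0 (hle c hc)
    obtain ⟨w, hw, h2⟩ := hQ.exists_span_singleton_mul_eq hn hd0 (hle d hd)
    have : Q * Q = Ideal.span {g} * Q * Ideal.span {z, w} := by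
      conv_lhs => enter [1]; rw [hQcd]
      rw [Ideal.span_insert, Ideal.sup_mul, h1, h2, Ideal.span_insert z, Ideal.mul_sup]
      ring_nf
    rw [hg] at this
    have h3 : g ∈ Ideal.span {g} * Q :=
      by
      have h4 : g ∈ Ideal.span {g} := Ideal.mem_span_singleton_self g
      rw [this] at h4
      exact Ideal.mul_le_left h4
    obtain ⟨q, hq, hgq⟩ := Ideal.mem_span_singleton_mul.1 h3
    have : q = 1 := mul_left_cancel₀ hg0 (by simpa using hgq)
    exact hnu q hq (this ▸ isUnit_one)
  · refine ⟨y, hy, ?_, hJ⟩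
    -- Otherwise `yQ = Q`, so `Q² = Q`, against Nakayama.
    by_contra hyQ
    rw [hQ.span_singleton_mul_eq hn hyQ] at hJ
    refine hQ0 (Submodule.eq_bot_of_le_smul_of_le_jacobson_bot Q Q hfg hJ.ge ?_)
    rw [IsLocalRing.jacobson_eq_maximalIdeal ⊥ bot_ne_top]
    exact fun s hs => hnu s hs

/-- A weak valuation property. If `(a, b)` is principal, one of `a`, `b` divides the other because
`A` is local. If it is `xQ`, then `Q` is generated by two elements, hence is the maximal ideal and
satisfies `Q² = yQ`; Nakayama then prevents both generators from lying in `yQ`. -/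
theorem span_singleton_mul_le_or_exists (hQ : IsPinchedBy Q) (hn : ¬ Q.IsPrincipal) {a b : A}
    (ha : a ≠ 0) (hb : b ≠ 0) :
    Ideal.span {a} * Q ≤ Ideal.span {b} * Q ∨ ∃ q ∈ Q, b = a * q := by
  have h0 : Ideal.span {a, b} ≠ ⊥ := fun h =>
    ha (by simpa [h] using Ideal.subset_span (s := {a, b}) (Set.mem_insert a {b}))
  have hQ0 := ne_bot_of_not_isPrincipal hn
  obtain ⟨g, hg⟩ | ⟨x, hx, hI⟩ := hQ _ h0
  · rw [Ideal.submodule_span_eq] at hg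
    have key : a ∣ b ∨ b ∣ a := by
      obtain ⟨u, hu⟩ : g ∣ a := by
        rw [← Ideal.mem_span_singleton, ← hg]; exact Ideal.subset_span (by simp)
      obtain ⟨v, hv⟩ : g ∣ b := by
        rw [← Ideal.mem_span_singleton, ← hg]; exact Ideal.subset_span (by simp)
      have hgI : g ∈ Ideal.span {a, b} := hg ▸ Ideal.mem_span_singleton_self g
      obtain ⟨s, t, hst⟩ := Ideal.mem_span_pair.1 hgI
      have hg0 : g ≠ 0 := by rintro rfl; simp at hu; exact ha hu
      have h1 : s * u + t * v = 1 := by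
        apply mul_left_cancel₀ hg0
        rw [hu, hv] at hst
        linear_combination hst
      obtain h | h := IsLocalRing.isUnit_or_isUnit_of_add_one h1
      · left
        rw [hu, hv]
        exact mul_dvd_mul_left g (isUnit_of_mul_isUnit_right h).dvd
      · right
        rw [hu, hv]
        exact mul_dvd_mul_left g (isUnit_of_mul_isUnit_right h).dvd
    obtain ⟨s, rfl⟩ | h := key
    · by_cases hs : s ∈ Q
      · exact Or.inr ⟨s, hs, rfl⟩
      · left
        rw [← Ideal.span_singleton_mul_span_singleton, mul_assoc, hQ.span_singleton_mul_eq hn hs]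
    · exact Or.inl (Ideal.mul_mono_left (Ideal.span_singleton_le_span_singleton.2 h))
  have haI : a ∈ Ideal.span {x} * Q := hI ▸ Ideal.subset_span (by simp)
  have hbI : b ∈ Ideal.span {x} * Q := hI ▸ Ideal.subset_span (by simp)
  obtain ⟨c, hc, rfl⟩ := Ideal.mem_span_singleton_mul.1 haI
  obtain ⟨d, hd, rfl⟩ := Ideal.mem_span_singleton_mul.1 hbI
  have hQcd : Q = Ideal.span {c, d} := by
    rw [← Ideal.span_singleton_mul_right_inj hx, ← hI, Ideal.span_mul_span']
    simp [Set.image_pair]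
  have hfg : Q.FG := hQcd ▸ (Submodule.fg_span (by simp))
  have hunit : ∀ s, s ∉ Q → IsUnit s := fun s hs => hQ.isUnit_of_notMem hn hfg hs
  have hnu : ∀ s ∈ Q, ¬ IsUnit s := fun s hs hu =>
    ne_top_of_not_isPrincipal hn (Ideal.eq_top_of_isUnit_mem Q hs hu)
  have hc0 : c ≠ 0 := right_ne_zero_of_mul ha
  have hd0 : d ≠ 0 := right_ne_zero_of_mul hb
  obtain ⟨y, hy, hyQ, hQQ⟩ := hQ.exists_mul_self_eq hn hQcd hc0 hd0
  have hle : ∀ w ∈ Q, Ideal.span {w} * Q ≤ Ideal.span {y} * Q := fun w hw =>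
    hQQ ▸ Ideal.mul_mono_left ((Ideal.span_singleton_le_iff_mem Q).2 hw)
  -- From `wQ ≤ yQ` comes `wQ = yzQ`; the alternative depends on whether `z` is a unit or in `Q`.
  have key : ∀ w ∈ Q, w ≠ 0 →
      Ideal.span {w} * Q = Ideal.span {y} * Q ∨ w ∈ Ideal.span {y} * Q := by
    intro w hw hw0
    obtain ⟨z, hz, h⟩ := hQ.exists_span_singleton_mul_eq hn hw0
      ((hle w hw).trans Ideal.mul_le_left)
    by_cases hzu : z ∈ Q
    · right
      have : w * y ∈ Ideal.span {y} * (Ideal.span {z} * Q) :=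
        h ▸ Ideal.mul_mem_mul (Ideal.mem_span_singleton_self w) hyQ
      obtain ⟨v, hv, hvw⟩ := Ideal.mem_span_singleton_mul.1 this
      have hwv : v = w := mul_left_cancel₀ hy (by linear_combination hvw)
      rw [← hQQ]
      exact hwv ▸ Ideal.mul_mono_left ((Ideal.span_singleton_le_iff_mem Q).2 hzu) hv
    · left
      rw [h, Ideal.span_singleton_eq_top.2 (hunit z hzu), Ideal.top_mul]
  simp only [← Ideal.span_singleton_mul_span_singleton, mul_assoc]
  obtain h1 | h1 := key d hd hd0
  · left
    rw [h1]
    exact Ideal.mul_mono_right (hle c hc)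
  obtain h2 | h2 := key c hc hc0
  · right
    rw [← h2] at h1
    obtain ⟨q, hq, rfl⟩ := Ideal.mem_span_singleton_mul.1 h1
    exact ⟨q, hq, rfl⟩
  · exfalso
    refine hQ0 (Ideal.eq_bot_of_fg_of_le_span_singleton_mul hfg (hnu y hyQ) ?_)
    conv_lhs => rw [hQcd]
    rw [Ideal.span_le]
    rintro _ (rfl | rfl)
    exacts [h2, h1]

end IsPinchedBy

/-! ### Overrings of a local MPD domain -/

section Overrings

variable {A : Type*} [CommRing A] (K : Type*) [Field K] [Algebra A K]

/-- The multiplier ring `(Q : Q)` of an ideal `Q` inside `K`. -/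
def Ideal.multiplierRing (Q : Ideal A) : Subalgebra A K where
  carrier := {k | ∀ q ∈ Q, ∃ q' ∈ Q, k * algebraMap A K q = algebraMap A K q'}
  mul_mem' := by
    intro a b ha hb q hq
    obtain ⟨q₁, hq₁, h₁⟩ := hb q hq
    obtain ⟨q₂, hq₂, h₂⟩ := ha q₁ hq₁
    exact ⟨q₂, hq₂, by rw [mul_assoc, h₁, h₂]⟩
  add_mem' := by
    intro a b ha hb q hq
    obtain ⟨q₁, hq₁, h₁⟩ := ha q hq
    obtain ⟨q₂, hq₂, h₂⟩ := hb q hq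
    exact ⟨q₁ + q₂, Q.add_mem hq₁ hq₂, by rw [add_mul, h₁, h₂, map_add]⟩
  algebraMap_mem' := by
    intro r q hq
    exact ⟨r * q, Q.mul_mem_left r hq, (map_mul _ _ _).symm⟩

variable {K}

theorem Ideal.mem_multiplierRing {Q : Ideal A} {k : K} : k ∈ Q.multiplierRing K ↔
    ∀ q ∈ Q, ∃ q' ∈ Q, k * algebraMap A K q = algebraMap A K q' :=
  Iff.rfl

variable [IsFractionRing A K]

/-- Every nonzero `a` divides a power of `s`, so inverting `s` inverts everything. -/
theorem Subalgebra.eq_top_of_inv_mem_of_forall_isPrime [IsDomain A] {R : Subalgebra A K} {s : A}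
    (hs : ∀ P : Ideal A, P.IsPrime → P ≠ ⊥ → s ∈ P) (hs0 : s ≠ 0)
    (hR : (algebraMap A K s)⁻¹ ∈ R) : R = ⊤ := by
  rw [eq_top_iff]
  rintro k -
  obtain ⟨b, a, ha, rfl⟩ := IsFractionRing.div_surjective A k
  have ha0 : a ≠ 0 := nonZeroDivisors.ne_zero ha
  have hrad : s ∈ (Ideal.span {a}).radical := by
    rw [Ideal.radical_eq_sInf, Submodule.mem_sInf]
    rintro P ⟨haP, hP⟩
    refine hs P hP ?_
    rintro rfl
    exact ha0 (by simpa using haP)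
  obtain ⟨n, hn⟩ := hrad
  obtain ⟨c, hc⟩ := Ideal.mem_span_singleton.1 hn
  have hsK : algebraMap A K s ≠ 0 := by simpa using hs0
  have haK : algebraMap A K a ≠ 0 := by simpa using ha0
  have : algebraMap A K b / algebraMap A K a =
      algebraMap A K (b * c) * (algebraMap A K s)⁻¹ ^ n := by
    rw [inv_pow, ← map_pow, hc, ← div_eq_mul_inv, div_eq_div_iff haK
      (by rw [← hc, map_pow]; exact pow_ne_zero n hsK), map_mul, map_mul]
    ring
  rw [this]
  exact R.mul_mem (R.algebraMap_mem _) (R.pow_mem hR n)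

theorem Subalgebra.eq_bot_or_eq_top_of_isPrincipalIdealRing [IsDomain A] [IsLocalRing A]
    (hA : ∀ I : Ideal A, I.IsPrincipal) (R : Subalgebra A K) : R = ⊥ ∨ R = ⊤ := by
  have : IsPrincipalIdealRing A := ⟨hA⟩
  have : ValuationRing A := inferInstance
  by_cases h : R = ⊥
  · exact Or.inl h
  right
  obtain ⟨r, hr, hrb⟩ := SetLike.not_le_iff_exists.1 (mt le_bot_iff.1 h)
  obtain ⟨s, hs⟩ | ⟨s, hs⟩ := ValuationRing.isInteger_or_isInteger A r
  · exact absurd (Algebra.mem_bot.2 ⟨s, hs⟩) hrb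
  have hr0 : r ≠ 0 := by
    rintro rfl
    exact hrb (zero_mem _)
  have hs0 : s ≠ 0 := by
    rintro rfl
    rw [map_zero] at hs
    exact inv_ne_zero hr0 hs.symm
  have hsu : ¬ IsUnit s := by
    rintro ⟨u, rfl⟩
    refine hrb (Algebra.mem_bot.2 ⟨↑u⁻¹, ?_⟩)
    have h1 : algebraMap A K ↑u * algebraMap A K ↑u⁻¹ = 1 := by
      rw [← map_mul, Units.mul_inv, map_one]
    rw [hs] at h1
    exact (inv_mul_eq_one₀ hr0).1 h1 |>.symm
  refine Subalgebra.eq_top_of_inv_mem_of_forall_isPrime (s := s) ?_ hs0 (by rwa [hs, inv_inv])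
  intro P hP hP0
  have := IsPrime.to_maximal_ideal (S := P) hP0
  rw [IsLocalRing.eq_maximalIdeal this]
  exact hsu

theorem IsPinchedBy.subalgebra_eq [IsDomain A] [IsLocalRing A] {Q : Ideal A}
    (hQ : IsPinchedBy Q) (hn : ¬ Q.IsPrincipal) (R : Subalgebra A K) :
    R = ⊥ ∨ R = Q.multiplierRing K ∨ R = ⊤ := by
  have hinj := IsFractionRing.injective A K
  have hQ0 := ne_bot_of_not_isPrincipal hn
  by_cases hRT : R ≤ Q.multiplierRing K
  · obtain ⟨q, hq, hq0⟩ := Submodule.exists_mem_ne_zero_of_ne_bot hQ0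
    have hqK : algebraMap A K q ≠ 0 := by simpa using hq0
    -- the ideal `q R` of `A`
    let I : Ideal A := Submodule.comap (Algebra.linearMap A K)
      (Submodule.map (LinearMap.mulLeft A (algebraMap A K q)) (Subalgebra.toSubmodule R))
    have hI : ∀ x, x ∈ I ↔ ∃ r ∈ R, algebraMap A K q * r = algebraMap A K x := fun x => Iff.rfl
    have hqI : q ∈ I := (hI q).2 ⟨1, R.one_mem, mul_one _⟩
    have hqR : ∀ r ∈ R, ∃ x ∈ I, algebraMap A K q * r = algebraMap A K x := by
      intro r hr
      obtain ⟨q', hq', h⟩ := hRT hr q hq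
      exact ⟨q', (hI q').2 ⟨r, hr, by rw [mul_comm, h]⟩, by rw [mul_comm, h]⟩
    have hI0 : I ≠ ⊥ := fun h => hq0 (by simpa [h] using hqI)
    obtain ⟨g, hg⟩ | ⟨x, hx, hx'⟩ := hQ I hI0
    -- Here `R = uA` with `u = g / q ∈ R`; then `u² ∈ uA` gives `u ∈ A`.
    · left
      rw [Ideal.submodule_span_eq] at hg
      obtain ⟨u, hu, hqu⟩ := (hI g).1 (hg ▸ Ideal.mem_span_singleton_self g)
      have hRu : ∀ r ∈ R, ∃ d : A, r = u * algebraMap A K d := by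
        intro r hr
        obtain ⟨x, hx, h⟩ := hqR r hr
        rw [hg] at hx
        obtain ⟨d, rfl⟩ := Ideal.mem_span_singleton.1 hx
        refine ⟨d, mul_left_cancel₀ hqK ?_⟩
        rw [h, map_mul, ← hqu, mul_assoc]
      obtain ⟨d, hd⟩ := hRu 1 R.one_mem
      have hu0 : u ≠ 0 := left_ne_zero_of_mul (hd ▸ one_ne_zero)
      obtain ⟨e, he⟩ := hRu (u * u) (R.mul_mem hu hu)
      have hue : u = algebraMap A K e := mul_left_cancel₀ hu0 he
      rw [eq_bot_iff]
      intro r hr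
      obtain ⟨f, rfl⟩ := hRu r hr
      rw [hue, ← map_mul]
      exact Subalgebra.algebraMap_mem _ _
    -- Here `R = (x / q)Q` is stable under `(Q : Q)` and contains 1.
    · right; left
      refine le_antisymm hRT ?_
      intro t ht
      rw [hx'] at hqI
      obtain ⟨w, hw, hxw⟩ := Ideal.mem_span_singleton_mul.1 hqI
      obtain ⟨w', hw', hww'⟩ := ht w hw
      have : x * w' ∈ I := hx' ▸ Ideal.mul_mem_mul (Ideal.mem_span_singleton_self x) hw'
      obtain ⟨r, hr, hqr⟩ := (hI _).1 this
      have : t = r := by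
        apply mul_left_cancel₀ hqK
        rw [hqr, map_mul, ← hww', ← hxw, map_mul]
        ring
      exact this ▸ hr
  · right; right
    obtain ⟨r, hr, hrT⟩ := SetLike.not_le_iff_exists.1 hRT
    obtain ⟨a, b, hb, rfl⟩ := IsFractionRing.div_surjective A r
    have hb0 : b ≠ 0 := nonZeroDivisors.ne_zero hb
    have hbK : algebraMap A K b ≠ 0 := by simpa using hb0
    have ha0 : a ≠ 0 := by
      rintro rfl
      rw [map_zero, zero_div] at hrT
      exact hrT (zero_mem _)
    have haK : algebraMap A K a ≠ 0 := by simpa using ha0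
    -- The second alternative puts `1 / q` in `R` with `q` in every nonzero prime.
    obtain h | ⟨q, hq, rfl⟩ := hQ.span_singleton_mul_le_or_exists hn ha0 hb0
    · refine absurd ?_ hrT
      intro q hq
      obtain ⟨q', hq', hqq'⟩ := Ideal.span_singleton_mul_le_span_singleton_mul.1 h q hq
      refine ⟨q', hq', ?_⟩
      rw [div_mul_eq_mul_div, div_eq_iff hbK, ← map_mul, ← map_mul, hqq', mul_comm]
    · refine Subalgebra.eq_top_of_inv_mem_of_forall_isPrime (s := q)
        (fun P hP hP0 => hQ.le_of_isPrime hn hP hP0 hq) (right_ne_zero_of_mul hb0) ?_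
      rwa [map_mul, div_mul_cancel_left₀ haK] at hr

theorem IsMPD.finite_overring [IsDomain A] [IsLocalRing A] (hA : IsMPD A) :
    Finite (Overring A K) := by
  obtain ⟨Q, hQmax, -, hQ⟩ := hA
  have hprin : ∀ I : Ideal A, IsInvertibleIdeal I → I.IsPrincipal := fun I hI => by
    refine Ideal.IsPrincipal.of_finite_maximals_of_isUnit ?_ hI
    exact (Set.finite_singleton (IsLocalRing.maximalIdeal A)).subset fun M hM =>
      IsLocalRing.eq_maximalIdeal hM
  have hinv0 : ∀ I : Ideal A, IsInvertibleIdeal I → I ≠ ⊥ := by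
    rintro I hI rfl
    simp [IsInvertibleIdeal] at hI
  by_cases hQ0 : Q = ⊥
  · have hall : ∀ I : Ideal A, I.IsPrincipal := fun I => by
      by_cases hI : I = ⊥
      · exact hI ▸ inferInstance
      · refine hprin I ?_
        by_contra hI'
        obtain ⟨J, -, hJ⟩ := hQ I hI hI'
        exact hI (by rw [hJ, hQ0, Ideal.mul_bot])
    refine Set.finite_univ_iff.1 ((Set.toFinite {⊥, ⊤}).subset fun R _ => ?_)
    exact Subalgebra.eq_bot_or_eq_top_of_isPrincipalIdealRing hall R
  · have hn : ¬ Q.IsPrincipal := by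
      rintro ⟨g, rfl⟩
      rw [Ideal.submodule_span_eq] at *
      refine hQmax.prop ?_
      have hg : g ≠ 0 := by simpa using hQ0
      rw [IsInvertibleIdeal, FractionalIdeal.coeIdeal_span_singleton]
      exact .of_mul_eq_one _ (FractionalIdeal.spanSingleton_mul_inv (FractionRing A) (by simpa))
    have hP : IsPinchedBy Q := fun I hI => by
      by_cases hI' : IsInvertibleIdeal I
      · exact Or.inl (hprin I hI')
      · obtain ⟨J, hJ, hIJ⟩ := hQ I hI hI'
        obtain ⟨x, rfl⟩ := hprin J hJ
        exact Or.inr ⟨x, fun h => hinv0 _ hJ (by simp [h]), hIJ⟩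
    exact Set.finite_univ_iff.1 ((Set.toFinite {⊥, Q.multiplierRing K, ⊤}).subset
      fun R _ => hP.subalgebra_eq hn R)

end Overrings

/-! ### Passage between `D` and its localizations -/

section Globalization

variable {D : Type*} [CommRing D] [IsDomain D] {K : Type*} [Field K] [Algebra D K]
  [IsFractionRing D K]

/-- The localization of a domain at a prime ideal, as a subring of the quotient field. -/
noncomputable def PrimeSpectrum.localizationOverring (K : Type*) [Field K] [Algebra D K]
    [IsFractionRing D K] (P : PrimeSpectrum D) : Overring D K :=
  Localization.subalgebra.ofField K P.asIdeal.primeCompl P.asIdeal.primeCompl_le_nonZeroDivisors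

theorem PrimeSpectrum.mem_localizationOverring {P : PrimeSpectrum D} {x : K} :
    x ∈ P.localizationOverring K ↔
      ∃ a s : D, ∃ _ : s ∉ P.asIdeal, x = algebraMap D K a * (algebraMap D K s)⁻¹ :=
  Iff.rfl

theorem PrimeSpectrum.inv_mem_localizationOverring {P : PrimeSpectrum D} {s : D} (hs : s ≠ 0) :
    (algebraMap D K s)⁻¹ ∈ P.localizationOverring K ↔ s ∉ P.asIdeal := by
  have hsK : algebraMap D K s ≠ 0 := by simpa using hs
  rw [mem_localizationOverring]
  constructor
  · rintro ⟨a, t, ht, h⟩ hsP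
    have htK : algebraMap D K t ≠ 0 := by
      have : t ≠ 0 := fun h => ht (h ▸ P.asIdeal.zero_mem)
      simpa using this
    have : t = a * s := by
      apply IsFractionRing.injective D K
      rw [map_mul]
      field_simp at h
      rw [h, mul_comm]
    exact ht (this ▸ P.asIdeal.mul_mem_left a hsP)
  · intro h
    exact ⟨1, s, h, by simp⟩

theorem PrimeSpectrum.localizationOverring_injective :
    Function.Injective (PrimeSpectrum.localizationOverring (D := D) K) := by
  intro P P' h
  ext s
  by_cases hs : s = 0
  · simp [hs]
  · rw [← not_iff_not, ← inv_mem_localizationOverring (K := K) hs, h,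
      inv_mem_localizationOverring hs]

/-- For distinct maximal ideals `M₀, M₁, …`, the rings `D_{M₀} ∩ … ∩ D_{Mₙ}` strictly decrease:
prime avoidance gives `s ∈ Mₙ₊₁` outside the earlier `Mᵢ`, and `1 / s` is lost at the next step. -/
theorem finite_maximalSpectrum_of_isChain_finite
    (h : ∀ C : Set (Overring D K), IsChain (· ≤ ·) C → C.Finite) :
    Finite (MaximalSpectrum D) := by
  by_contra hinf
  rw [not_finite_iff_infinite] at hinf
  let f := Infinite.natEmbedding (MaximalSpectrum D)
  let R : ℕ → Overring D K := fun n =>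
    ⨅ i ∈ Finset.range (n + 1), (f i).toPrimeSpectrum.localizationOverring K
  have hR : StrictAnti R := by
    refine strictAnti_nat_of_succ_lt fun n => lt_of_le_not_ge ?_ ?_
    · exact biInf_mono fun i hi => Finset.range_subset_range.2 (n + 1).le_succ hi
    · intro hle
      have hav : ¬ ((f (n + 1)).asIdeal : Set D) ⊆
          ⋃ i ∈ (↑(Finset.range (n + 1)) : Set ℕ), ((f i).asIdeal : Set D) := by
        rw [Ideal.subset_union_prime 0 0 fun i _ _ _ => (f i).isMaximal.isPrime]
        rintro ⟨i, hi, hle⟩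
        have := (f (n + 1)).isMaximal.eq_of_le (f i).isMaximal.ne_top hle
        have := f.injective (MaximalSpectrum.ext this)
        simp [this] at hi
      obtain ⟨s, hs, hs'⟩ := Set.not_subset.1 hav
      simp only [Set.mem_iUnion, not_exists] at hs'
      -- The intersection always involves index 0, so `s` avoids at least one ideal.
      have hs0 : s ≠ 0 := fun h => hs' 0 (by simp) (h ▸ zero_mem _)
      have h1 : (algebraMap D K s)⁻¹ ∈ R n := by
        simp only [R, Algebra.mem_iInf]
        exact fun i hi => (PrimeSpectrum.inv_mem_localizationOverring hs0).2 (hs' i hi)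
      have h2 := hle h1
      simp only [R, Algebra.mem_iInf] at h2
      exact (PrimeSpectrum.inv_mem_localizationOverring hs0).1 (h2 (n + 1) (by simp)) hs
  refine Set.infinite_range_of_injective hR.injective (h _ ?_)
  rintro _ ⟨i, rfl⟩ _ ⟨j, rfl⟩ -
  exact (le_total j i).imp (fun h => hR.antitone h) fun h => hR.antitone h

/-- The map `R ↦ (D_M R)_M` is injective: if `x ∈ D_M R'` for all `M`, the ideal of `s` with `s x ∈
R'` lies in no maximal ideal, so it contains 1. -/
theorem finite_overring_of_finite_maximalSpectrum [Finite (MaximalSpectrum D)]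
    (h : ∀ (M : Ideal D) [M.IsMaximal] [Algebra (Localization.AtPrime M) K]
      [IsScalarTower D (Localization.AtPrime M) K], Finite (Overring (Localization.AtPrime M) K)) :
    Finite (Overring D K) := by
  have hle : ∀ M : MaximalSpectrum D, M.asIdeal.primeCompl ≤ nonZeroDivisors D :=
    fun M => M.asIdeal.primeCompl_le_nonZeroDivisors
  let (M : MaximalSpectrum D) : Algebra (Localization.AtPrime M.asIdeal) K :=
    IsLocalization.localizationAlgebraOfSubmonoidLe _ _ M.asIdeal.primeCompl (nonZeroDivisors D)
      (hle M)
  have (M : MaximalSpectrum D) : IsScalarTower D (Localization.AtPrime M.asIdeal) K :=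
    IsLocalization.localization_isScalarTower_of_submonoid_le _ _ M.asIdeal.primeCompl
      (nonZeroDivisors D) (hle M)
  have (M : MaximalSpectrum D) : Finite (Overring (Localization.AtPrime M.asIdeal) K) :=
    h M.asIdeal
  let F : Overring D K → (M : MaximalSpectrum D) → Overring (Localization.AtPrime M.asIdeal) K :=
    fun R M => Algebra.adjoin (Localization.AtPrime M.asIdeal) (R : Set K)
  -- Denominators of elements of `D_M R` can be cleared by a single `s ∉ M`.
  have hF : ∀ R M x, x ∈ F R M → ∃ s ∉ M.asIdeal, algebraMap D K s * x ∈ R := by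
    intro R M x hx
    induction hx using Algebra.adjoin_induction with
    | mem x hx => exact ⟨1, M.asIdeal.primeCompl.one_mem, by simpa using hx⟩
    | algebraMap r =>
      obtain ⟨a, s, rfl⟩ := IsLocalization.exists_mk'_eq M.asIdeal.primeCompl r
      refine ⟨s, s.2, ?_⟩
      rw [IsScalarTower.algebraMap_apply D (Localization.AtPrime M.asIdeal) K, ← map_mul,
        IsLocalization.mk'_spec', ← IsScalarTower.algebraMap_apply]
      exact R.algebraMap_mem a
    | add x y _ _ hx hy =>
      obtain ⟨s, hs, hsx⟩ := hx
      obtain ⟨t, ht, hty⟩ := hy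
      refine ⟨s * t, M.asIdeal.primeCompl.mul_mem hs ht, ?_⟩
      have : algebraMap D K (s * t) * (x + y) = algebraMap D K t * (algebraMap D K s * x) +
          algebraMap D K s * (algebraMap D K t * y) := by
        rw [map_mul]; ring
      rw [this]
      exact R.add_mem (R.mul_mem (R.algebraMap_mem _) hsx) (R.mul_mem (R.algebraMap_mem _) hty)
    | mul x y _ _ hx hy =>
      obtain ⟨s, hs, hsx⟩ := hx
      obtain ⟨t, ht, hty⟩ := hy
      refine ⟨s * t, M.asIdeal.primeCompl.mul_mem hs ht, ?_⟩
      have : algebraMap D K (s * t) * (x * y) =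
          (algebraMap D K s * x) * (algebraMap D K t * y) := by
        rw [map_mul]; ring
      rw [this]
      exact R.mul_mem hsx hty
  have hmono : ∀ R R' : Overring D K, F R = F R' → R ≤ R' := by
    intro R R' hRR' x hx
    let I : Ideal D := Submodule.comap (LinearMap.toSpanSingleton D K x) (Subalgebra.toSubmodule R')
    have hI : ∀ s, s ∈ I ↔ algebraMap D K s * x ∈ R' := fun s => by
      simp [I, Algebra.smul_def]
    have htop : I = ⊤ := by
      by_contra hne
      obtain ⟨M, hM, hIM⟩ := Ideal.exists_le_maximal I hne
      have hxF : x ∈ F R' ⟨M, hM⟩ := hRR' ▸ Algebra.subset_adjoin hx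
      obtain ⟨s, hs, hsx⟩ := hF R' ⟨M, hM⟩ x hxF
      exact hs (hIM ((hI s).2 hsx))
    simpa using (hI 1).1 (htop ▸ Submodule.mem_top)
  exact Finite.of_injective F fun R R' h => le_antisymm (hmono R R' h) (hmono R' R h.symm)

end Globalization

theorem proposition2p2 (D : Type*) [CommRing D] [IsDomain D] (K : Type*) [Field K] [Algebra D K]
    [IsFractionRing D K] (hD : IsGMPD D) :
    List.TFAE [
      Finite (Overring D K),
      ∀ C : Set (Overring D K), IsChain (· ≤ ·) C → C.Finite,
      Finite (PrimeSpectrum D),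
      Finite (MaximalSpectrum D)] := by
  tfae_have 1 → 2 := fun h C _ => Set.toFinite C
  tfae_have 2 → 4 := finite_maximalSpectrum_of_isChain_finite
  tfae_have 1 → 3 := fun h =>
    Finite.of_injective _ (PrimeSpectrum.localizationOverring_injective (K := K))
  tfae_have 3 → 4 := fun h =>
    Finite.of_injective _ MaximalSpectrum.toPrimeSpectrum_injective
  tfae_have 4 → 1 := fun h => by
    refine finite_overring_of_finite_maximalSpectrum fun M _ _ _ => ?_
    have : IsDomain (Localization.AtPrime M) :=
      IsLocalization.isDomain_localization M.primeCompl_le_nonZeroDivisors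
    have : IsFractionRing (Localization.AtPrime M) K :=
      IsFractionRing.isFractionRing_of_isDomain_of_isLocalization M.primeCompl _ _
    exact (hD.isMPD_localization M).finite_overring
  tfae_finish
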